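/- Let $d\ge 1$ and $1\le p,q\le\infty$ with $p\neq q$. Fix a non-zero window $g\in\mathcal S(\mathbb R^d)$ and, for $f\in\mathcal S'(\mathbb R^d)$, let $$V_gf(x,\eta)=\langle f,M_\eta T_xg\rangle=\int_{\mathbb R^d} f(t)\,\overline{g(t-x)}\,e^{-2\pi i\eta\cdot t}\,dt,\qquad x,\eta\in\mathbb R^d,$$ be its short-time Fourier transform, where $M_\eta T_xg(t)=e^{2\pi i\eta\cdot t}g(t-x)$ and $\langle f,\varphi\rangle$ is the pairing of $f\in\mathcal S'$ with $\varphi\in\mathcal S$ that extends $\int f\overline{\varphi}$ (the integral being understood in this sense). Put $$\|f\|_{M^{p,q}}=\left(\int_{\mathbb R^d}\Big(\int_{\mathbb R^d}|V_gf(x,\eta)|^p\,dx\Big)^{q/p}d\eta\right)^{1/q}\in[0,\infty],$$ with the usual essential suprema if $p=\infty$ or $q=\infty$, and let $M^{p,q}=M^{p,q}(\mathbb R^d)=\{f\in\mathcal S'(\mathbb R^d):\|f\|_{M^{p,q}}<\infty\}$. Then the chirp multiplication $Uf(x)=e^{\pi i|x|^2}f(x)$, acting on $\mathcal S'(\mathbb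 R^d)$, is unbounded on $M^{p,q}$: there is no constant $C\geq 0$ such that $$\|Uf\|_{M^{p,q}}\le C\,\|f\|_{M^{p,q}}\qquad\text{for all } f\in M^{p,q}.$$ The same holds if $M^{p,q}$ is replaced by the closure of $\mathcal S(\mathbb R^d)$ in $M^{p,q}$: no constant $C\ge 0$ satisfies this inequality for all $f$ in that closure. -/

import Mathlib

open MeasureTheory Complex
open scoped SchwartzMap ENNReal NNReal

noncomputable section

namespace ModulationSpaces

/-- `t ↦ e^{i t}` has temperate growth. -/
theorem hasTemperateGrowth_exp_I :
    (fun t : ℝ => Complex.exp (Complex.I * (t : ℂ))).HasTemperateGrowth := by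
  have hd : ∀ n : ℕ, iteratedDeriv n (fun t : ℝ => Complex.exp (Complex.I * (t : ℂ))) =
      fun t : ℝ => Complex.I ^ n * Complex.exp (Complex.I * (t : ℂ)) := by
    intro n
    induction n with
    | zero => simp
    | succ n ih =>
      rw [iteratedDeriv_succ, ih]
      funext t
      have h1 : HasDerivAt (fun t : ℝ => Complex.I * (t : ℂ)) Complex.I t := by
        simpa using (Complex.ofRealCLM.hasDerivAt (x := t)).const_mul Complex.I
      rw [(h1.cexp.const_mul (Complex.I ^ n)).deriv]
      ring
  refine ⟨?_, fun n => ⟨0, 1, fun t => ?_⟩⟩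
  · exact (contDiff_const.mul Complex.ofRealCLM.contDiff).cexp
  · rw [norm_iteratedFDeriv_eq_norm_iteratedDeriv, hd n]
    simp [mul_comm Complex.I, Complex.norm_exp_ofReal_mul_I]

/-- The character `t ↦ e^{2πi η·t}`. -/
def character {d : ℕ} (η : EuclideanSpace ℝ (Fin d)) (t : EuclideanSpace ℝ (Fin d)) : ℂ :=
  Complex.exp (2 * Real.pi * Complex.I * ((inner ℝ η t : ℝ) : ℂ))

/-- The chirp `t ↦ e^{πi |t|²}`. -/
def chirp {d : ℕ} (t : EuclideanSpace ℝ (Fin d)) : ℂ :=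
  Complex.exp (Real.pi * Complex.I * ((‖t‖ ^ 2 : ℝ) : ℂ))

theorem hasTemperateGrowth_character {d : ℕ} (η : EuclideanSpace ℝ (Fin d)) :
    (character η).HasTemperateGrowth := by
  have h : (fun t : EuclideanSpace ℝ (Fin d) =>
      (2 * Real.pi) * inner ℝ η t).HasTemperateGrowth :=
    (Function.HasTemperateGrowth.const (2 * Real.pi)).mul
      (Function.hasTemperateGrowth_inner_right η)
  convert hasTemperateGrowth_exp_I.comp h using 1
  funext t
  simp only [character, Function.comp_apply]
  congr 1
  push_cast
  ring

theorem hasTemperateGrowth_chirp {d : ℕ} :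
    (chirp (d := d)).HasTemperateGrowth := by
  have h : (fun t : EuclideanSpace ℝ (Fin d) => Real.pi * ‖t‖ ^ 2).HasTemperateGrowth :=
    (Function.HasTemperateGrowth.const Real.pi).mul
      (Function.hasTemperateGrowth_norm_sq _)
  convert hasTemperateGrowth_exp_I.comp h using 1
  funext t
  simp only [chirp, Function.comp_apply]
  congr 1
  push_cast
  ring

/-- The time-frequency shift `M_η T_x g`, that is `t ↦ e^{2πi η·t} g(t - x)`. -/
def tfShift {d : ℕ} (x η : EuclideanSpace ℝ (Fin d)) (g : 𝓢(EuclideanSpace ℝ (Fin d), ℂ)) :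
    𝓢(EuclideanSpace ℝ (Fin d), ℂ) :=
  SchwartzMap.smulLeftCLM ℂ (character η) (SchwartzMap.compSubConstCLM ℂ x g)

theorem tfShift_apply {d : ℕ} (x η : EuclideanSpace ℝ (Fin d))
    (g : 𝓢(EuclideanSpace ℝ (Fin d), ℂ)) (t : EuclideanSpace ℝ (Fin d)) :
    tfShift x η g t = character η t * g (t - x) := by
  simp [tfShift, hasTemperateGrowth_character η]

/-- The complex conjugate of a Schwartz function. -/
def conjSchwartz {d : ℕ} (g : 𝓢(EuclideanSpace ℝ (Fin d), ℂ)) :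
    𝓢(EuclideanSpace ℝ (Fin d), ℂ) :=
  SchwartzMap.postcompCLM (𝕜 := ℝ) (Complex.conjCLE : ℂ →L[ℝ] ℂ) g

/-- The short-time Fourier transform `V_g f(x, η) = ⟨f, M_η T_x g⟩` of a tempered distribution `f`.
The bracket is conjugate-linear in its second argument, so it is the value of `f` at the conjugate
of `M_η T_x g`. -/
def stft {d : ℕ} (g : 𝓢(EuclideanSpace ℝ (Fin d), ℂ)) (f : 𝓢'(EuclideanSpace ℝ (Fin d), ℂ))
    (x η : EuclideanSpace ℝ (Fin d)) : ℂ :=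
  f (conjSchwartz (tfShift x η g))

/-- For a Schwartz function `f`, `V_g f(x, η) = ∫ f(t) conj(g(t - x)) e^{-2πi η·t} dt`. -/
theorem stft_toTemperedDistribution {d : ℕ} (g f : 𝓢(EuclideanSpace ℝ (Fin d), ℂ))
    (x η : EuclideanSpace ℝ (Fin d)) :
    stft g (SchwartzMap.toTemperedDistributionCLM (EuclideanSpace ℝ (Fin d)) ℂ volume f) x η =
      ∫ t, f t * (starRingEnd ℂ) (g (t - x)) *
        Complex.exp (-(2 * Real.pi * Complex.I * ((inner ℝ η t : ℝ) : ℂ))) := by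
  refine (SchwartzMap.toTemperedDistributionCLM_apply_apply volume f
    (conjSchwartz (tfShift x η g))).trans ?_
  refine integral_congr_ae (Filter.Eventually.of_forall fun t => ?_)
  have h : conjSchwartz (tfShift x η g) t = (starRingEnd ℂ) (tfShift x η g t) := rfl
  simp only [h, tfShift_apply, character, map_mul, ← Complex.exp_conj, Complex.conj_I,
    Complex.conj_ofReal, smul_eq_mul, Complex.conj_ofNat]
  ring_nf

/-- The `M^{p,q}` norm with window `g`, with values in `[0, ∞]`: the `L^q` norm in `η` of the
`L^p` norm in `x` of `V_g f(x, η)`. -/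
def modNorm {d : ℕ} (g : 𝓢(EuclideanSpace ℝ (Fin d), ℂ)) (p q : ℝ≥0∞)
    (f : 𝓢'(EuclideanSpace ℝ (Fin d), ℂ)) : ℝ≥0∞ :=
  eLpNorm (fun η : EuclideanSpace ℝ (Fin d) =>
    eLpNorm (fun x : EuclideanSpace ℝ (Fin d) => stft g f x η) p volume) q volume

/-- The modulation space `M^{p,q}`: all tempered distributions with finite `M^{p,q}` norm. -/
def modulationSpace {d : ℕ} (g : 𝓢(EuclideanSpace ℝ (Fin d), ℂ)) (p q : ℝ≥0∞) :
    Set 𝓢'(EuclideanSpace ℝ (Fin d), ℂ) :=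
  {f | modNorm g p q f < ∞}

/-- The closure of the Schwartz class in `M^{p,q}`. -/
def schwartzClosure {d : ℕ} (g : 𝓢(EuclideanSpace ℝ (Fin d), ℂ)) (p q : ℝ≥0∞) :
    Set 𝓢'(EuclideanSpace ℝ (Fin d), ℂ) :=
  {f | f ∈ modulationSpace g p q ∧ ∀ ε : ℝ≥0∞, 0 < ε →
    ∃ φ : 𝓢(EuclideanSpace ℝ (Fin d), ℂ), modNorm g p q
      (f - SchwartzMap.toTemperedDistributionCLM (EuclideanSpace ℝ (Fin d)) ℂ volume φ) < ε}

/-- The chirp multiplication `U f(x) = e^{πi |x|²} f(x)` on tempered distributions. -/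
def chirpMul {d : ℕ} :
    𝓢'(EuclideanSpace ℝ (Fin d), ℂ) →L[ℂ] 𝓢'(EuclideanSpace ℝ (Fin d), ℂ) :=
  TemperedDistribution.smulLeftCLM ℂ chirp

/-- `chirpMul` is pointwise multiplication by the chirp on Schwartz functions. -/
theorem chirpMul_toTemperedDistribution {d : ℕ} (f : 𝓢(EuclideanSpace ℝ (Fin d), ℂ)) :
    chirpMul (SchwartzMap.toTemperedDistributionCLM (EuclideanSpace ℝ (Fin d)) ℂ volume f) =
      SchwartzMap.toTemperedDistributionCLM (EuclideanSpace ℝ (Fin d)) ℂ volume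
        (SchwartzMap.smulLeftCLM ℂ chirp f) := by
  ext φ
  refine (SchwartzMap.toTemperedDistributionCLM_apply_apply volume f
    (SchwartzMap.smulLeftCLM ℂ chirp φ)).trans
    (Eq.trans ?_ (SchwartzMap.toTemperedDistributionCLM_apply_apply volume
      (SchwartzMap.smulLeftCLM ℂ chirp f) φ).symm)
  refine integral_congr_ae (Filter.Eventually.of_forall fun t => ?_)
  simp only [SchwartzMap.smulLeftCLM_apply_apply hasTemperateGrowth_chirp, smul_eq_mul]
  ring

/-- `T` is bounded on the space `X` with respect to the `M^{p,q}` norm. As norms take values in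
`[0, ∞]`, the inequality includes that `T f` has finite norm for every `f` in
`X ⊆ M^{p,q}`. -/
def IsBoundedOn {d : ℕ} (g : 𝓢(EuclideanSpace ℝ (Fin d), ℂ)) (p q : ℝ≥0∞)
    (X : Set 𝓢'(EuclideanSpace ℝ (Fin d), ℂ))
    (T : 𝓢'(EuclideanSpace ℝ (Fin d), ℂ) →L[ℂ] 𝓢'(EuclideanSpace ℝ (Fin d), ℂ)) : Prop :=
  ∃ C : ℝ≥0, ∀ f ∈ X, modNorm g p q (T f) ≤ C * modNorm g p q f

end ModulationSpaces

end

noncomputable section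

namespace ModulationSpaces

open scoped FourierTransform RealInnerProductSpace

variable {d : ℕ}

/-! The test functions are sums of `N` widely separated translates of one Schwartz function. In
phase space such a sum is `N` bumps at the points `(a i, 0)`: they share their frequencies, so the
inner `L^p` norm in `x` sees all of them and the norm is comparable to `N^{1/p}`. A chirp of rate
`±1` shears phase space and moves the bumps to `(a i, ±a i)`. Each frequency then meets essentially
one bump, the counting passes to the outer `L^q` norm, and the norm is comparable to `N^{1/q}`.

If `q < p`, chirping the plain sum gains `N^{1/q - 1/p}`. If `p < q`, the sum is chirped with rate
`-1` beforehand, `U` undoes this, and the gain is `N^{1/p - 1/q}`. Either factor is unbounded in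
`N`. All test functions are Schwartz, so both spaces are covered at once.

The shear is `norm_stft_rateChirpMul`. The upper bounds rest on the decay `exists_norm_stft_le` and
on `eLpNorm_sum_weight_le`, the lower bounds on `exists_le_norm_stft_sumTranslates`. -/

/-- A Schwartz function seen as a tempered distribution. -/
abbrev toDist (f : 𝓢(EuclideanSpace ℝ (Fin d), ℂ)) : 𝓢'(EuclideanSpace ℝ (Fin d), ℂ) :=
  SchwartzMap.toTemperedDistributionCLM (EuclideanSpace ℝ (Fin d)) ℂ volume f

/-! ### Polynomial weights and decay of correlations -/

/-- The weight `(1 + ‖x‖)^{-(d+1)}`, integrable on `ℝ^d`. -/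
def weight (x : EuclideanSpace ℝ (Fin d)) : ℝ := ((1 + ‖x‖) ^ (d + 1))⁻¹

theorem weight_pos (x : EuclideanSpace ℝ (Fin d)) : 0 < weight x := by
  unfold weight; positivity

theorem weight_le_one (x : EuclideanSpace ℝ (Fin d)) : weight x ≤ 1 :=
  inv_le_one_of_one_le₀ (one_le_pow₀ (by linarith [norm_nonneg x]))

theorem continuous_weight : Continuous (weight (d := d)) := by
  unfold weight
  exact Continuous.inv₀ (by fun_prop) fun x => by positivity

theorem integrable_weight : Integrable (weight (d := d)) := by
  have h := integrable_one_add_norm (μ := (volume : Measure (EuclideanSpace ℝ (Fin d))))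
    (r := (d + 1 : ℕ)) (by simp)
  refine h.congr (Filter.Eventually.of_forall fun x => ?_)
  simp only [weight]
  rw [Real.rpow_neg (by positivity), Real.rpow_natCast]

/-- This is `1 + ‖x + y‖ ≤ (1 + ‖x‖) (1 + ‖y‖)`, inverted. -/
theorem weight_mul_weight_le (x y : EuclideanSpace ℝ (Fin d)) :
    weight x * weight y ≤ weight (x + y) := by
  unfold weight
  rw [← mul_inv, ← mul_pow]
  refine inv_anti₀ (by positivity) (pow_le_pow_left₀ (by positivity) ?_ _)
  nlinarith [norm_add_le x y, norm_nonneg x, norm_nonneg y,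
    mul_nonneg (norm_nonneg x) (norm_nonneg y)]

theorem weight_neg (x : EuclideanSpace ℝ (Fin d)) : weight (-x) = weight x := by
  simp [weight]

/-- For large arguments the weight is at most the inverse of the norm. -/
theorem weight_le_inv {x : EuclideanSpace ℝ (Fin d)} {R : ℝ} (hR : 0 < R) (hx : R ≤ ‖x‖) :
    weight x ≤ R⁻¹ := by
  refine inv_anti₀ hR ?_
  calc R ≤ (1 + ‖x‖) ^ 1 := by rw [pow_one]; linarith
    _ ≤ (1 + ‖x‖) ^ (d + 1) := pow_le_pow_right₀ (by linarith) (by omega)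

/-- Schwartz functions decay faster than every power of the weight. -/
theorem exists_norm_le_weight_pow (f : 𝓢(EuclideanSpace ℝ (Fin d), ℂ)) (n : ℕ) :
    ∃ C : ℝ, 0 ≤ C ∧ ∀ x, ‖f x‖ ≤ C * weight x ^ n := by
  refine ⟨2 ^ ((d + 1) * n) * (Finset.Iic ((d + 1) * n, 0)).sup
    (fun m => SchwartzMap.seminorm ℝ m.1 m.2) f, by positivity, fun x => ?_⟩
  have h := SchwartzMap.one_add_le_sup_seminorm_apply (𝕜 := ℝ) (m := ((d + 1) * n, 0))
    le_rfl le_rfl f x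
  rw [norm_iteratedFDeriv_zero] at h
  rw [weight, inv_pow, ← pow_mul, ← div_eq_mul_inv, le_div_iff₀ (by positivity), mul_comm]
  exact h

theorem integrable_norm_mul_norm_sub (f h : 𝓢(EuclideanSpace ℝ (Fin d), ℂ))
    (x : EuclideanSpace ℝ (Fin d)) : Integrable fun t => ‖f t‖ * ‖h (t - x)‖ := by
  obtain ⟨C, hC, hb⟩ := exists_norm_le_weight_pow h 0
  refine (f.integrable.norm.mul_const C).mono' ?_ (Filter.Eventually.of_forall fun t => ?_)
  · have := f.continuous
    have := h.continuous
    exact Continuous.aestronglyMeasurable (by fun_prop)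
  · rw [Real.norm_of_nonneg (by positivity)]
    gcongr
    simpa using hb (t - x)

/-- Correlations of Schwartz functions decay faster than every power of the weight. -/
theorem exists_integral_norm_mul_norm_sub_le (f h : 𝓢(EuclideanSpace ℝ (Fin d), ℂ)) (n : ℕ) :
    ∃ C : ℝ, 0 ≤ C ∧ ∀ x, ∫ t, ‖f t‖ * ‖h (t - x)‖ ≤ C * weight x ^ n := by
  -- The extra power of the weight on `f` makes the integral over `t` converge; the other `n`
  -- combine with those of `h` into decay in `x`.
  obtain ⟨A, hA, hf⟩ := exists_norm_le_weight_pow f (n + 1)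
  obtain ⟨B, hB, hh⟩ := exists_norm_le_weight_pow h n
  refine ⟨A * B * ∫ t, weight (d := d) t, mul_nonneg (mul_nonneg hA hB)
    (integral_nonneg fun t => (weight_pos t).le), fun x => ?_⟩
  calc ∫ t, ‖f t‖ * ‖h (t - x)‖ ≤ ∫ t, A * B * weight x ^ n * weight t := by
        refine integral_mono (integrable_norm_mul_norm_sub f h x)
          (integrable_weight.const_mul _) fun t => ?_
        have h1 : weight t * weight (t - x) ≤ weight x := by
          have := weight_mul_weight_le t (-(t - x))
          rwa [weight_neg, show t + -(t - x) = x by abel] at this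
        have h2 := pow_le_pow_left₀ (mul_nonneg (weight_pos t).le (weight_pos _).le) h1 n
        have := (weight_pos t).le
        have := (weight_pos (t - x)).le
        calc ‖f t‖ * ‖h (t - x)‖ ≤ (A * weight t ^ (n + 1)) * (B * weight (t - x) ^ n) := by
              gcongr
              exacts [hf t, hh _]
          _ = A * B * (weight t * weight (t - x)) ^ n * weight t := by ring
          _ ≤ _ := by gcongr
    _ = _ := by rw [integral_const_mul]; ring

/-! ### Decay of the short-time Fourier transform in time and frequency -/

theorem norm_character (η t : EuclideanSpace ℝ (Fin d)) : ‖character η t‖ = 1 := by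
  rw [character, show (2 * Real.pi * I * ((inner ℝ η t : ℝ) : ℂ)) =
    ((2 * Real.pi * inner ℝ η t : ℝ) : ℂ) * I by push_cast; ring]
  exact Complex.norm_exp_ofReal_mul_I _

theorem norm_exp_neg_character (η t : EuclideanSpace ℝ (Fin d)) :
    ‖Complex.exp (-(2 * Real.pi * I * ((inner ℝ η t : ℝ) : ℂ)))‖ = 1 := by
  rw [Complex.exp_neg, norm_inv, ← character, norm_character, inv_one]

theorem norm_stft_le_time (h f : 𝓢(EuclideanSpace ℝ (Fin d), ℂ))
    (x η : EuclideanSpace ℝ (Fin d)) :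
    ‖stft h (toDist f) x η‖ ≤ ∫ t, ‖f t‖ * ‖h (t - x)‖ := by
  rw [stft_toTemperedDistribution]
  refine (norm_integral_le_integral_norm _).trans_eq (integral_congr_ae
    (Filter.Eventually.of_forall fun t => ?_))
  simp [norm_exp_neg_character]

/-- The Fourier transform turns the modulation by `η` into a translation and the translation by `x`
into a phase. -/
theorem norm_fourier_tfShift (h : 𝓢(EuclideanSpace ℝ (Fin d), ℂ))
    (x η ξ : EuclideanSpace ℝ (Fin d)) : ‖𝓕 (tfShift x η h) ξ‖ = ‖𝓕 h (ξ - η)‖ := by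
  rw [SchwartzMap.fourier_coe, SchwartzMap.fourier_coe, Real.fourier_eq', Real.fourier_eq',
    ← integral_add_right_eq_self _ x]
  have key : ∀ t, Complex.exp (↑(-2 * Real.pi * inner ℝ (t + x) ξ) * I) • tfShift x η h (t + x) =
      Complex.exp (↑(-2 * Real.pi * inner ℝ x (ξ - η)) * I) *
        (Complex.exp (↑(-2 * Real.pi * inner ℝ t (ξ - η)) * I) • h t) := fun t => by
    rw [tfShift_apply, character, add_sub_cancel_right, smul_eq_mul, smul_eq_mul, ← mul_assoc,
      ← mul_assoc, ← Complex.exp_add, ← Complex.exp_add]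
    congr 2
    rw [real_inner_comm (t + x) η]
    simp only [inner_add_left, inner_sub_right]
    push_cast
    ring
  simp_rw [key]
  rw [integral_const_mul, norm_mul, Complex.norm_exp_ofReal_mul_I, one_mul]

theorem stft_eq_integral_inner (h f : 𝓢(EuclideanSpace ℝ (Fin d), ℂ))
    (x η : EuclideanSpace ℝ (Fin d)) :
    stft h (toDist f) x η = ∫ t, inner ℂ (tfShift x η h t) (f t) := by
  refine (SchwartzMap.toTemperedDistributionCLM_apply_apply volume f
    (conjSchwartz (tfShift x η h))).trans ?_
  refine integral_congr_ae (Filter.Eventually.of_forall fun t => ?_)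
  have h : conjSchwartz (tfShift x η h) t = (starRingEnd ℂ) (tfShift x η h t) := rfl
  simp [h, mul_comm]

/-- By Plancherel, the bound is a correlation on the Fourier side, which yields decay in `η`
uniformly in `x`. -/
theorem norm_stft_le_frequency (h f : 𝓢(EuclideanSpace ℝ (Fin d), ℂ))
    (x η : EuclideanSpace ℝ (Fin d)) :
    ‖stft h (toDist f) x η‖ ≤ ∫ ξ, ‖𝓕 f ξ‖ * ‖𝓕 h (ξ - η)‖ := by
  rw [stft_eq_integral_inner, ← SchwartzMap.integral_inner_fourier_fourier]
  refine (norm_integral_le_integral_norm _).trans_eq (integral_congr_ae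
    (Filter.Eventually.of_forall fun ξ => ?_))
  simp [norm_fourier_tfShift]

/-- The short-time Fourier transform of a Schwartz function decays in time and frequency. -/
theorem exists_norm_stft_le (h f : 𝓢(EuclideanSpace ℝ (Fin d), ℂ)) :
    ∃ C : ℝ, 0 < C ∧ ∀ x η, ‖stft h (toDist f) x η‖ ≤ C * weight x ^ 2 * weight η ^ 2 := by
  obtain ⟨A, hA, h1⟩ := exists_integral_norm_mul_norm_sub_le f h 4
  obtain ⟨B, hB, h2⟩ := exists_integral_norm_mul_norm_sub_le (𝓕 f) (𝓕 h) 4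
  refine ⟨A + B + 1, by positivity, fun x η => ?_⟩
  have ha := (norm_stft_le_time h f x η).trans (h1 x)
  have hb := (norm_stft_le_frequency h f x η).trans (h2 η)
  have hx := weight_pos x
  have hη := weight_pos η
  -- The geometric mean of the time bound and the frequency bound: fourth powers of each weight
  -- become squares of both.
  refine abs_le_of_sq_le_sq' ?_ (by positivity) |>.2
  calc ‖stft h (toDist f) x η‖ ^ 2 = ‖stft h (toDist f) x η‖ * ‖stft h (toDist f) x η‖ := sq _
    _ ≤ (A * weight x ^ 4) * (B * weight η ^ 4) := by gcongr
    -- A common constant makes the product a perfect square; the `+ 1` makes it positive.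
    _ ≤ ((A + B + 1) * weight x ^ 4) * ((A + B + 1) * weight η ^ 4) := by
        gcongr <;> linarith
    _ = _ := by ring

/-! ### Behaviour under translations, sums and chirps -/

theorem norm_stft_translate (h f : 𝓢(EuclideanSpace ℝ (Fin d), ℂ))
    (a x η : EuclideanSpace ℝ (Fin d)) :
    ‖stft h (toDist (SchwartzMap.compSubConstCLM ℂ a f)) x η‖ =
      ‖stft h (toDist f) (x - a) η‖ := by
  rw [stft_toTemperedDistribution, stft_toTemperedDistribution,
    ← integral_add_right_eq_self _ a]
  have key : ∀ t, SchwartzMap.compSubConstCLM ℂ a f (t + a) * (starRingEnd ℂ) (h (t + a - x)) *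
      Complex.exp (-(2 * Real.pi * I * ((inner ℝ η (t + a) : ℝ) : ℂ))) =
      Complex.exp (-(2 * Real.pi * I * ((inner ℝ η a : ℝ) : ℂ))) *
      (f t * (starRingEnd ℂ) (h (t - (x - a))) *
        Complex.exp (-(2 * Real.pi * I * ((inner ℝ η t : ℝ) : ℂ)))) := fun t => by
    rw [SchwartzMap.compSubConstCLM_apply, add_sub_cancel_right,
      show t + a - x = t - (x - a) by abel, inner_add_right,
      show -(2 * Real.pi * I * ((inner ℝ η t + inner ℝ η a : ℝ) : ℂ)) =
        -(2 * Real.pi * I * ((inner ℝ η t : ℝ) : ℂ)) +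
        -(2 * Real.pi * I * ((inner ℝ η a : ℝ) : ℂ)) by push_cast; ring, Complex.exp_add]
    ring
  simp_rw [key]
  rw [integral_const_mul, norm_mul, norm_exp_neg_character, one_mul]

theorem stft_sum {ι : Type*} (s : Finset ι) (h : 𝓢(EuclideanSpace ℝ (Fin d), ℂ))
    (f : ι → 𝓢(EuclideanSpace ℝ (Fin d), ℂ)) (x η : EuclideanSpace ℝ (Fin d)) :
    stft h (toDist (∑ i ∈ s, f i)) x η = ∑ i ∈ s, stft h (toDist (f i)) x η := by
  simp only [stft_eq_integral_inner, sum_apply, inner_sum]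
  refine integral_finsetSum _ fun i _ => ?_
  refine (integrable_norm_mul_norm_sub (f i) h x).mono' ?_
    (Filter.Eventually.of_forall fun t => ?_)
  · have := (f i).continuous
    have := (tfShift x η h).continuous
    exact Continuous.aestronglyMeasurable (by fun_prop)
  · refine (norm_inner_le_norm _ _).trans_eq ?_
    rw [tfShift_apply, norm_mul, norm_character, one_mul, mul_comm]

/-- The chirp `t ↦ e^{πi s |t|²}` of rate `s`. -/
def rateChirp (s : ℝ) (t : EuclideanSpace ℝ (Fin d)) : ℂ :=
  Complex.exp (((Real.pi * s * ‖t‖ ^ 2 : ℝ) : ℂ) * I)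

theorem hasTemperateGrowth_rateChirp (s : ℝ) :
    (rateChirp (d := d) s).HasTemperateGrowth := by
  have h : (fun t : EuclideanSpace ℝ (Fin d) => Real.pi * s * ‖t‖ ^ 2).HasTemperateGrowth :=
    (Function.HasTemperateGrowth.const (Real.pi * s)).mul
      (Function.hasTemperateGrowth_norm_sq _)
  convert hasTemperateGrowth_exp_I.comp h using 1
  funext t
  simp only [rateChirp, Function.comp_apply, mul_comm]

/-- Multiplication of a Schwartz function by the chirp of rate `s`. -/
def rateChirpMul (s : ℝ) (f : 𝓢(EuclideanSpace ℝ (Fin d), ℂ)) :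
    𝓢(EuclideanSpace ℝ (Fin d), ℂ) :=
  SchwartzMap.smulLeftCLM ℂ (rateChirp s) f

theorem rateChirpMul_apply (s : ℝ) (f : 𝓢(EuclideanSpace ℝ (Fin d), ℂ))
    (t : EuclideanSpace ℝ (Fin d)) : rateChirpMul s f t = rateChirp s t * f t := by
  simp [rateChirpMul, hasTemperateGrowth_rateChirp s]

theorem rateChirp_add (s r : ℝ) (t : EuclideanSpace ℝ (Fin d)) :
    rateChirp (s + r) t = rateChirp s t * rateChirp r t := by
  rw [rateChirp, rateChirp, rateChirp, ← Complex.exp_add]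
  congr 1
  push_cast
  ring

theorem rateChirpMul_rateChirpMul_neg (s : ℝ) (f : 𝓢(EuclideanSpace ℝ (Fin d), ℂ)) :
    rateChirpMul s (rateChirpMul (-s) f) = f := by
  ext t
  rw [rateChirpMul_apply, rateChirpMul_apply, ← mul_assoc, ← rateChirp_add]
  simp [rateChirp]

theorem chirpMul_toDist (f : 𝓢(EuclideanSpace ℝ (Fin d), ℂ)) :
    chirpMul (toDist f) = toDist (rateChirpMul 1 f) := by
  have h : chirp (d := d) = rateChirp 1 := by
    funext t
    rw [chirp, rateChirp]
    congr 1
    push_cast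
    ring
  rw [chirpMul_toTemperedDistribution, h, rateChirpMul]

/-- A chirp acts on the short-time Fourier transform by a shear of phase space. -/
theorem norm_stft_rateChirpMul (s : ℝ) (h f : 𝓢(EuclideanSpace ℝ (Fin d), ℂ))
    (x η : EuclideanSpace ℝ (Fin d)) :
    ‖stft h (toDist (rateChirpMul s f)) x η‖ =
      ‖stft (rateChirpMul (-s) h) (toDist f) x (η - s • x)‖ := by
  rw [stft_toTemperedDistribution, stft_toTemperedDistribution]
  have key : ∀ t, rateChirpMul s f t * (starRingEnd ℂ) (h (t - x)) *
      Complex.exp (-(2 * Real.pi * I * ((inner ℝ η t : ℝ) : ℂ))) =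
      Complex.exp (((-(Real.pi * s * ‖x‖ ^ 2) : ℝ) : ℂ) * I) *
      (f t * (starRingEnd ℂ) (rateChirpMul (-s) h (t - x)) *
        Complex.exp (-(2 * Real.pi * I * ((inner ℝ (η - s • x) t : ℝ) : ℂ)))) := fun t => by
    -- Completing the square: `s‖t‖² = s‖t - x‖² + 2s x·t - s‖x‖²`. The terms go to the window, to
    -- the frequency and to a constant phase.
    have e : Complex.exp (((Real.pi * s * ‖t‖ ^ 2 : ℝ) : ℂ) * I) *
        Complex.exp (-(2 * Real.pi * I * ((inner ℝ η t : ℝ) : ℂ))) =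
        Complex.exp (((-(Real.pi * s * ‖x‖ ^ 2) : ℝ) : ℂ) * I) *
        Complex.exp (((Real.pi * s * ‖t - x‖ ^ 2 : ℝ) : ℂ) * I) *
        Complex.exp (-(2 * Real.pi * I * ((inner ℝ (η - s • x) t : ℝ) : ℂ))) := by
      rw [← Complex.exp_add, ← Complex.exp_add, ← Complex.exp_add]
      congr 1
      rw [norm_sub_sq_real, inner_sub_left, real_inner_smul_left, real_inner_comm t x]
      push_cast
      ring
    have c : (starRingEnd ℂ) (rateChirp (-s) (t - x)) =
        Complex.exp (((Real.pi * s * ‖t - x‖ ^ 2 : ℝ) : ℂ) * I) := by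
      rw [rateChirp, ← Complex.exp_conj, map_mul, Complex.conj_I, Complex.conj_ofReal]
      congr 1
      push_cast
      ring
    rw [rateChirpMul_apply, rateChirpMul_apply, map_mul, c, rateChirp]
    linear_combination (f t * (starRingEnd ℂ) (h (t - x))) * e
  simp_rw [key]
  rw [integral_const_mul, norm_mul, Complex.norm_exp_ofReal_mul_I, one_mul]

/-! ### Lower bound near the origin of phase space -/

theorem continuous_stft (h f : 𝓢(EuclideanSpace ℝ (Fin d), ℂ)) :
    Continuous fun z : EuclideanSpace ℝ (Fin d) × EuclideanSpace ℝ (Fin d) =>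
      stft h (toDist f) z.1 z.2 := by
  obtain ⟨C, hC, hb⟩ := exists_norm_le_weight_pow h 0
  have hf := f.continuous
  have hh := h.continuous
  simp only [stft_toTemperedDistribution]
  refine continuous_of_dominated (bound := fun t => ‖f t‖ * C) (fun z => ?_) (fun z => ?_)
    (f.integrable.norm.mul_const C) (Filter.Eventually.of_forall fun t => ?_)
  · exact Continuous.aestronglyMeasurable (by fun_prop)
  · refine Filter.Eventually.of_forall fun t => ?_
    rw [norm_mul, norm_exp_neg_character, mul_one, norm_mul, RCLike.norm_conj]
    gcongr
    simpa using hb (t - z.1)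
  · fun_prop

/-- The value at the origin is the squared `L²` norm of `h`. -/
theorem stft_self_ne_zero {h : 𝓢(EuclideanSpace ℝ (Fin d), ℂ)} (hh : h ≠ 0) :
    stft h (toDist h) 0 0 ≠ 0 := by
  have e : stft h (toDist h) 0 0 = ((∫ t, ‖h t‖ ^ 2 : ℝ) : ℂ) := by
    rw [stft_toTemperedDistribution, ← integral_complex_ofReal]
    refine integral_congr_ae (Filter.Eventually.of_forall fun t => ?_)
    simp [Complex.mul_conj, Complex.normSq_eq_norm_sq]
  rw [e, Complex.ofReal_ne_zero]
  have hc := h.continuous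
  have hi : Integrable fun t => ‖h t‖ ^ 2 := by
    simpa [sq] using integrable_norm_mul_norm_sub h h 0
  refine ((integral_pos_iff_support_of_nonneg (fun t => by positivity) hi).2 ?_).ne'
  have ho : IsOpen (Function.support fun t => ‖h t‖ ^ 2) :=
    (show Continuous fun t => ‖h t‖ ^ 2 by fun_prop).isOpen_support
  refine ho.measure_pos _ ?_
  by_contra hne
  refine hh (SchwartzMap.ext fun t => ?_)
  by_contra ht
  exact hne ⟨t, by simpa using ht⟩

/-- The short-time Fourier transform of a window with itself is bounded below near the origin. -/
theorem exists_le_norm_stft_self {h : 𝓢(EuclideanSpace ℝ (Fin d), ℂ)} (hh : h ≠ 0) :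
    ∃ c r : ℝ, 0 < c ∧ 0 < r ∧ r ≤ 1 ∧ ∀ x η, ‖x‖ < r → ‖η‖ < r →
      c ≤ ‖stft h (toDist h) x η‖ := by
  have h0 : 0 < ‖stft h (toDist h) 0 0‖ := norm_pos_iff.2 (stft_self_ne_zero hh)
  have hev := (continuous_stft h h).norm.continuousAt (x := (0, 0)) |>.eventually
    (lt_mem_nhds (half_lt_self h0))
  obtain ⟨r, hr, hball⟩ := Metric.eventually_nhds_iff.1 hev
  refine ⟨_, min r 1, half_pos h0, lt_min hr one_pos, min_le_right _ _, fun x η hx hη => ?_⟩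
  refine (hball (y := (x, η)) ?_).le
  rw [Prod.dist_eq]
  simpa using ⟨hx.trans_le (min_le_left _ _), hη.trans_le (min_le_left _ _)⟩

/-! ### Norm estimates for sums over separated points -/

/-- A point within `R` of one centre is at distance at least `R` from all others, by the separation
`2 * R`. -/
theorem sum_erase_weight_le {d : ℕ} {ι : Type*} [DecidableEq ι] {s : Finset ι}
    {a : ι → EuclideanSpace ℝ (Fin d)} {R : ℝ} (hR : 0 < R)
    (ha : ∀ i j, i ≠ j → 2 * R ≤ ‖a i - a j‖) {j : ι} {x : EuclideanSpace ℝ (Fin d)}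
    (hx : ‖x - a j‖ ≤ R) : ∑ i ∈ s.erase j, weight (x - a i) ≤ s.card * R⁻¹ := by
  calc ∑ i ∈ s.erase j, weight (x - a i) ≤ ∑ i ∈ s.erase j, R⁻¹ := by
        refine Finset.sum_le_sum fun i hi => weight_le_inv hR ?_
        have h1 := ha i j (Finset.ne_of_mem_erase hi)
        have h2 := norm_sub_le (x - a j) (x - a i)
        rw [show x - a j - (x - a i) = a i - a j by abel] at h2
        linarith
    _ ≤ s.card * R⁻¹ := by
        rw [Finset.sum_const, nsmul_eq_mul]
        gcongr
        exact Finset.erase_subset j s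

/-- At most one centre lies within `R` of `x` and contributes at most `1`; the others together
contribute at most `s.card / R ≤ 1`. -/
theorem sum_weight_le_two {d : ℕ} {ι : Type*} {s : Finset ι}
    {a : ι → EuclideanSpace ℝ (Fin d)} {R : ℝ} (hR : 0 < R) (hs : s.card ≤ R)
    (ha : ∀ i j, i ≠ j → 2 * R ≤ ‖a i - a j‖) (x : EuclideanSpace ℝ (Fin d)) :
    ∑ i ∈ s, weight (x - a i) ≤ 2 := by
  classical
  have h1 : s.card * R⁻¹ ≤ 1 := by
    rw [← div_eq_mul_inv]; exact (div_le_one hR).2 hs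
  by_cases h : ∃ j ∈ s, ‖x - a j‖ ≤ R
  · obtain ⟨j, hj, hx⟩ := h
    rw [← Finset.add_sum_erase s _ hj]
    linarith [weight_le_one (x - a j), sum_erase_weight_le (s := s) hR ha hx]
  · push Not at h
    calc ∑ i ∈ s, weight (x - a i) ≤ ∑ i ∈ s, R⁻¹ :=
          Finset.sum_le_sum fun i hi => weight_le_inv hR (h i hi).le
      _ ≤ 2 := by rw [Finset.sum_const, nsmul_eq_mul]; linarith

/-- A constant `K` such that sums of `N` well separated translates of the weight have `L^p` norm at
most `K N^{1/p}`. -/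
def weightConst (d : ℕ) (p : ℝ≥0∞) : ℝ≥0∞ :=
  2 * (∫⁻ x, ‖weight (d := d) x‖ₑ) ^ (1 / p.toReal)

/-- Interpolation between the uniform bound `2` and the `L¹` norm, which is linear in the number of
translates. -/
theorem eLpNorm_sum_weight_le {d : ℕ} {ι : Type*} {s : Finset ι}
    {a : ι → EuclideanSpace ℝ (Fin d)} {R : ℝ} (hR : 0 < R) (hs : s.card ≤ R)
    (ha : ∀ i j, i ≠ j → 2 * R ≤ ‖a i - a j‖) {p : ℝ≥0∞} (hp : 1 ≤ p) :
    eLpNorm (fun x => ∑ i ∈ s, weight (x - a i)) p volume ≤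
      weightConst d p * (s.card : ℝ≥0∞) ^ (1 / p.toReal) := by
  unfold weightConst
  have hb : ∀ x, ‖∑ i ∈ s, weight (x - a i)‖ₑ ≤ 2 := fun x => by
    rw [Real.enorm_of_nonneg (Finset.sum_nonneg fun i _ => (weight_pos _).le)]
    exact (ENNReal.ofReal_le_ofReal (sum_weight_le_two hR hs ha x)).trans (by simp)
  -- Since `∞.toReal = 0`, the exponent `1 / p.toReal` is `0` here and the claimed bound is `2`.
  rcases eq_or_ne p ∞ with rfl | hp'
  · rw [eLpNorm_exponent_top]
    simpa using eLpNormEssSup_le_of_ae_enorm_bound (Filter.Eventually.of_forall hb)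
  have hp1 : 1 ≤ p.toReal := by
    rw [← ENNReal.toReal_one]; exact ENNReal.toReal_mono hp' hp
  rw [eLpNorm_eq_lintegral_rpow_enorm_toReal (by positivity) hp']
  have hint : ∫⁻ x, ‖∑ i ∈ s, weight (x - a i)‖ₑ ^ p.toReal ≤
      2 ^ p.toReal * (s.card * ∫⁻ x, ‖weight (d := d) x‖ₑ) := by
    have hm : Measurable fun x : EuclideanSpace ℝ (Fin d) => ‖weight x‖ₑ :=
      continuous_weight.measurable.enorm
    calc ∫⁻ x, ‖∑ i ∈ s, weight (x - a i)‖ₑ ^ p.toReal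
        ≤ ∫⁻ x, 2 ^ p.toReal * ∑ i ∈ s, ‖weight (x - a i)‖ₑ := by
          refine lintegral_mono fun x => ?_
          calc ‖∑ i ∈ s, weight (x - a i)‖ₑ ^ p.toReal
              = ‖∑ i ∈ s, weight (x - a i)‖ₑ ^ (p.toReal - 1) *
                ‖∑ i ∈ s, weight (x - a i)‖ₑ ^ (1 : ℝ) := by
                rw [← ENNReal.rpow_add_of_nonneg _ _ (by linarith) zero_le_one, sub_add_cancel]
            _ ≤ 2 ^ (p.toReal - 1) * ‖∑ i ∈ s, weight (x - a i)‖ₑ := by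
                rw [ENNReal.rpow_one]
                gcongr
                exact hb x
            _ ≤ 2 ^ p.toReal * ∑ i ∈ s, ‖weight (x - a i)‖ₑ := by
                gcongr
                exacts [by norm_num, by linarith, enorm_sum_le _ _]
      _ = _ := by
          have hm' : ∀ i ∈ s, Measurable fun x => ‖weight (x - a i)‖ₑ := fun i _ =>
            hm.comp (measurable_id.sub_const (a i))
          rw [lintegral_const_mul _ (Finset.measurable_fun_sum _ hm'), lintegral_finsetSum _ hm']
          congr 1
          rw [Finset.sum_congr rfl fun i _ =>
            lintegral_sub_right_eq_self (fun x => ‖weight (d := d) x‖ₑ) (a i),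
            Finset.sum_const, nsmul_eq_mul]
  calc (∫⁻ x, ‖∑ i ∈ s, weight (x - a i)‖ₑ ^ p.toReal) ^ (1 / p.toReal)
      ≤ (2 ^ p.toReal * (s.card * ∫⁻ x, ‖weight (d := d) x‖ₑ)) ^ (1 / p.toReal) :=
        ENNReal.rpow_le_rpow hint (by positivity)
    _ = _ := by
        rw [ENNReal.mul_rpow_of_nonneg _ _ (by positivity),
          ENNReal.mul_rpow_of_nonneg _ _ (by positivity), ← ENNReal.rpow_mul,
          mul_one_div_cancel (by linarith), ENNReal.rpow_one]
        ring

theorem weightConst_ne_top (d : ℕ) (p : ℝ≥0∞) : weightConst d p ≠ ∞ :=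
  ENNReal.mul_ne_top (by simp) (ENNReal.rpow_ne_top_of_nonneg (by positivity)
    integrable_weight.2.ne)

theorem eLpNorm_weight_le {d : ℕ} (y : EuclideanSpace ℝ (Fin d)) {p : ℝ≥0∞} (hp : 1 ≤ p) :
    eLpNorm (fun x => weight (x - y)) p volume ≤ weightConst d p := by
  simpa using eLpNorm_sum_weight_le (s := {()}) (a := fun _ : Unit => y)
    one_pos (by simp) (fun i j h => (h rfl).elim) hp

/-- The outer norm in `modNorm` is taken of a `[0, ∞]`-valued function; this reduces it to a
real-valued one, where homogeneity applies. -/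
theorem eLpNorm_const_mul_enorm {α : Type*} [MeasurableSpace α] {μ : Measure α} {K : ℝ≥0∞}
    (hK : K ≠ ∞) (G : α → ℝ) (q : ℝ≥0∞) :
    eLpNorm (fun x => K * ‖G x‖ₑ) q μ = K * eLpNorm G q μ := by
  have hc : ‖K.toReal‖ₑ = K := by
    rw [Real.enorm_of_nonneg ENNReal.toReal_nonneg, ENNReal.ofReal_toReal hK]
  have h := eLpNorm_const_smul (μ := μ) K.toReal G q
  rw [hc] at h
  rw [← h]
  refine eLpNorm_congr_enorm_ae (Filter.Eventually.of_forall fun x => ?_)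
  simp [hc]

/-- Comparison with `c` times the indicator of `S`. For `p = ∞` the left side is `c`, hence the
condition that `S` is not null. -/
theorem mul_rpow_measure_le_eLpNorm {α ε : Type*} [MeasurableSpace α] [TopologicalSpace ε]
    [ContinuousENorm ε] {μ : Measure α} {f : α → ε} {c p : ℝ≥0∞} {S : Set α}
    (hS : MeasurableSet S) (hS0 : μ S ≠ 0) (hp : p ≠ 0) (h : ∀ x ∈ S, c ≤ ‖f x‖ₑ) :
    c * μ S ^ (1 / p.toReal) ≤ eLpNorm f p μ := by
  have := eLpNorm_indicator_const' (c := c) hS hS0 hp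
  rw [enorm_eq_self] at this
  rw [← this]
  refine eLpNorm_mono_enorm fun x => ?_
  by_cases hx : x ∈ S
  · simpa [hx] using h x hx
  · simp [hx]

theorem measure_biUnion_ball {d : ℕ} {ι : Type*} {s : Finset ι}
    {a : ι → EuclideanSpace ℝ (Fin d)} {R r : ℝ} (hr : r ≤ R)
    (ha : ∀ i j, i ≠ j → 2 * R ≤ ‖a i - a j‖) :
    volume (⋃ i ∈ s, Metric.ball (a i) r) =
      s.card * volume (Metric.ball (0 : EuclideanSpace ℝ (Fin d)) r) := by
  rw [measure_biUnion_finset (fun i _ j _ hij => Metric.ball_disjoint_ball ?_)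
    fun i _ => measurableSet_ball]
  · simp [Measure.addHaar_ball_center]
  · rw [dist_eq_norm]
    linarith [ha i j hij]

/-! ### Two-sided bounds for sums of sparse translates, plain and chirped -/

/-- The sum of the translates of `f` by the points `a i`, `i ∈ s`. -/
def sumTranslates {d : ℕ} {ι : Type*} (s : Finset ι) (a : ι → EuclideanSpace ℝ (Fin d))
    (f : 𝓢(EuclideanSpace ℝ (Fin d), ℂ)) : 𝓢(EuclideanSpace ℝ (Fin d), ℂ) :=
  ∑ i ∈ s, SchwartzMap.compSubConstCLM ℂ (a i) f

theorem norm_stft_sumTranslates_le {d : ℕ} {ι : Type*} {s : Finset ι}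
    {a : ι → EuclideanSpace ℝ (Fin d)} {h f : 𝓢(EuclideanSpace ℝ (Fin d), ℂ)} {C : ℝ}
    (hC : ∀ x η, ‖stft h (toDist f) x η‖ ≤ C * weight x ^ 2 * weight η ^ 2)
    (x η : EuclideanSpace ℝ (Fin d)) :
    ‖stft h (toDist (sumTranslates s a f)) x η‖ ≤
      C * ∑ i ∈ s, weight (x - a i) ^ 2 * weight η ^ 2 := by
  rw [sumTranslates, stft_sum, Finset.mul_sum]
  refine norm_sum_le_of_le _ fun i _ => ?_
  rw [norm_stft_translate, ← mul_assoc]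
  exact hC _ _

/-- Sums of `N` sparse translates have `M^{p,q}` norm `O(N^{1/p})`. -/
theorem exists_modNorm_sumTranslates_le {d : ℕ} (h f : 𝓢(EuclideanSpace ℝ (Fin d), ℂ))
    {p q : ℝ≥0∞} (hp : 1 ≤ p) (hq : 1 ≤ q) :
    ∃ K : ℝ≥0∞, K ≠ ∞ ∧ ∀ (s : Finset ℕ) (a : ℕ → EuclideanSpace ℝ (Fin d)) (R : ℝ), 0 < R →
      s.card ≤ R → (∀ i j, i ≠ j → 2 * R ≤ ‖a i - a j‖) →
      modNorm h p q (toDist (sumTranslates s a f)) ≤ K * (s.card : ℝ≥0∞) ^ (1 / p.toReal) := by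
  obtain ⟨C, hC0, hC⟩ := exists_norm_stft_le h f
  refine ⟨ENNReal.ofReal C * weightConst d p * weightConst d q, ENNReal.mul_ne_top
    (ENNReal.mul_ne_top ENNReal.ofReal_ne_top (weightConst_ne_top d p)) (weightConst_ne_top d q),
    fun s a R hR hs ha => ?_⟩
  set N : ℝ≥0∞ := (s.card : ℝ≥0∞) ^ (1 / p.toReal)
  have hN : N ≠ ∞ := ENNReal.rpow_ne_top_of_nonneg (by positivity) (by simp)
  have inner_le : ∀ η, eLpNorm (fun x => stft h (toDist (sumTranslates s a f)) x η) p volume ≤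
      ENNReal.ofReal C * weightConst d p * N * ‖weight η‖ₑ := fun η => by
    have hw := weight_pos η
    calc eLpNorm (fun x => stft h (toDist (sumTranslates s a f)) x η) p volume
        ≤ eLpNorm ((C * weight η) • fun x => ∑ i ∈ s, weight (x - a i)) p volume := by
          refine eLpNorm_mono_real fun x => (norm_stft_sumTranslates_le hC x η).trans ?_
          simp only [Pi.smul_apply, smul_eq_mul, mul_assoc]
          rw [Finset.mul_sum _ _ (weight η)]
          refine mul_le_mul_of_nonneg_left (Finset.sum_le_sum fun i _ => ?_) hC0.le
          have h1 := weight_pos (x - a i)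
          calc weight (x - a i) ^ 2 * weight η ^ 2
              = (weight η * weight (x - a i)) * (weight (x - a i) * weight η) := by ring
            _ ≤ (weight η * weight (x - a i)) * (1 * 1) := by
                gcongr <;> exact weight_le_one _
            _ = _ := by ring
      _ ≤ ‖C * weight η‖ₑ * (weightConst d p * N) := by
          rw [eLpNorm_const_smul]
          gcongr
          exact eLpNorm_sum_weight_le hR hs ha hp
      _ = _ := by
          rw [enorm_mul, Real.enorm_of_nonneg hC0.le]
          ring
  calc modNorm h p q (toDist (sumTranslates s a f))
      ≤ eLpNorm (fun η => ENNReal.ofReal C * weightConst d p * N *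
          ‖weight (d := d) η‖ₑ) q volume := by
        refine eLpNorm_mono_enorm fun η => ?_
        simpa only [enorm_eq_self] using inner_le η
    _ ≤ ENNReal.ofReal C * weightConst d p * N * weightConst d q := by
        rw [eLpNorm_const_mul_enorm (ENNReal.mul_ne_top (ENNReal.mul_ne_top
          ENNReal.ofReal_ne_top (weightConst_ne_top d p)) hN)]
        gcongr
        simpa using eLpNorm_weight_le (d := d) 0 hq
    _ = _ := by ring

/-- Chirped sums of `N` sparse translates have `M^{p,q}` norm `O(N^{1/q})`. -/
theorem exists_modNorm_rateChirpMul_sumTranslates_le {d : ℕ}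
    (h f : 𝓢(EuclideanSpace ℝ (Fin d), ℂ)) {p q : ℝ≥0∞} (hp : 1 ≤ p) (hq : 1 ≤ q) :
    ∃ K : ℝ≥0∞, K ≠ ∞ ∧ ∀ (s : Finset ℕ) (a : ℕ → EuclideanSpace ℝ (Fin d)) (R : ℝ), 0 < R →
      s.card ≤ R → (∀ i j, i ≠ j → 2 * R ≤ ‖a i - a j‖) →
      modNorm h p q (toDist (rateChirpMul (-1) (sumTranslates s a f))) ≤
        K * (s.card : ℝ≥0∞) ^ (1 / q.toReal) := by
  obtain ⟨C, hC0, hC⟩ := exists_norm_stft_le (rateChirpMul (- -1) h) f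
  refine ⟨ENNReal.ofReal C * weightConst d p * weightConst d q, ENNReal.mul_ne_top
    (ENNReal.mul_ne_top ENNReal.ofReal_ne_top (weightConst_ne_top d p)) (weightConst_ne_top d q),
    fun s a R hR hs ha => ?_⟩
  set G : EuclideanSpace ℝ (Fin d) → ℝ := fun η => ∑ i ∈ s, weight (η - -a i)
  have inner_le : ∀ η, eLpNorm (fun x =>
      stft h (toDist (rateChirpMul (-1) (sumTranslates s a f))) x η) p volume ≤
      ENNReal.ofReal C * weightConst d p * ‖G η‖ₑ := fun η => by
    calc eLpNorm (fun x => stft h (toDist (rateChirpMul (-1) (sumTranslates s a f))) x η) p volume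
        ≤ eLpNorm ((C * G η) • fun x => weight (x - -η)) p volume := by
          refine eLpNorm_mono_real fun x => ?_
          rw [norm_stft_rateChirpMul]
          refine (norm_stft_sumTranslates_le hC x _).trans ?_
          simp only [Pi.smul_apply, smul_eq_mul, mul_assoc, G]
          rw [Finset.sum_mul]
          refine mul_le_mul_of_nonneg_left (Finset.sum_le_sum fun i _ => ?_) hC0.le
          rw [show η - (-1 : ℝ) • x = x - -η by rw [neg_one_smul]; abel]
          have h1 := weight_pos (x - a i)
          have h2 := weight_pos (x - -η)
          have h3 := weight_mul_weight_le (-(x - a i)) (x - -η)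
          rw [weight_neg, show -(x - a i) + (x - -η) = η - -a i by abel] at h3
          -- One factor of each weight merges into a bump in `η` at `-a i`, independent of `x`; the
          -- remaining `weight (x - -η)` carries the `L^p` norm in `x`. This is why squared decay is
          -- needed.
          calc weight (x - a i) ^ 2 * weight (x - -η) ^ 2
              = weight (x - a i) * (weight (x - a i) * weight (x - -η)) * weight (x - -η) := by
                ring
            _ ≤ 1 * weight (η - -a i) * weight (x - -η) := by
                gcongr
                exact weight_le_one _
            _ = _ := by ring
      _ ≤ ‖C * G η‖ₑ * weightConst d p := by
          rw [eLpNorm_const_smul]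
          gcongr
          exact eLpNorm_weight_le _ hp
      _ = _ := by
          rw [enorm_mul, Real.enorm_of_nonneg hC0.le]
          ring
  calc modNorm h p q (toDist (rateChirpMul (-1) (sumTranslates s a f)))
      ≤ eLpNorm (fun η => ENNReal.ofReal C * weightConst d p * ‖G η‖ₑ) q volume := by
        refine eLpNorm_mono_enorm fun η => ?_
        simpa only [enorm_eq_self] using inner_le η
    _ ≤ ENNReal.ofReal C * weightConst d p *
          (weightConst d q * (s.card : ℝ≥0∞) ^ (1 / q.toReal)) := by
        rw [eLpNorm_const_mul_enorm (ENNReal.mul_ne_top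
          ENNReal.ofReal_ne_top (weightConst_ne_top d p))]
        gcongr
        refine eLpNorm_sum_weight_le hR hs (fun i j hij => ?_) hq
        rw [show -a i - -a j = a j - a i by abel]
        exact ha j i hij.symm
    _ = _ := by ring

/-- The short-time Fourier transform of a sum of sparse translates is bounded below near each of
the translation points. -/
theorem exists_le_norm_stft_sumTranslates {d : ℕ} {h : 𝓢(EuclideanSpace ℝ (Fin d), ℂ)}
    (hh : h ≠ 0) : ∃ c r A : ℝ, 0 < c ∧ 0 < r ∧ r ≤ 1 ∧
      ∀ (s : Finset ℕ) (a : ℕ → EuclideanSpace ℝ (Fin d)) (R : ℝ), 1 ≤ R →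
      A * s.card ≤ R → (∀ i j, i ≠ j → 2 * R ≤ ‖a i - a j‖) →
      ∀ j ∈ s, ∀ x η, ‖x - a j‖ < r → ‖η‖ < r →
        c ≤ ‖stft h (toDist (sumTranslates s a h)) x η‖ := by
  obtain ⟨c, r, hc, hr, hr1, hlow⟩ := exists_le_norm_stft_self hh
  obtain ⟨C, hC0, hC⟩ := exists_norm_stft_le h h
  -- With `A = 2 * C / c`, the other translates add up to at most `c / 2`, half of the main term.
  refine ⟨c / 2, r, 2 * C / c, half_pos hc, hr, hr1, fun s a R hR hs ha j hj x η hx hη => ?_⟩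
  have hR0 : 0 < R := by linarith
  rw [sumTranslates, stft_sum, ← Finset.add_sum_erase s _ hj]
  have hmain : c ≤ ‖stft h (toDist (SchwartzMap.compSubConstCLM ℂ (a j) h)) x η‖ := by
    rw [norm_stft_translate]
    exact hlow _ _ hx hη
  have hoff : ‖∑ i ∈ s.erase j, stft h (toDist (SchwartzMap.compSubConstCLM ℂ (a i) h)) x η‖ ≤
      c / 2 := by
    calc ‖∑ i ∈ s.erase j, stft h (toDist (SchwartzMap.compSubConstCLM ℂ (a i) h)) x η‖
        ≤ ∑ i ∈ s.erase j, C * weight (x - a i) := by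
          refine norm_sum_le_of_le _ fun i _ => ?_
          rw [norm_stft_translate]
          refine (hC _ _).trans ?_
          have h1 := weight_pos (x - a i)
          have h2 := weight_pos η
          calc C * weight (x - a i) ^ 2 * weight η ^ 2
              = C * weight (x - a i) * (weight (x - a i) * weight η ^ 2) := by ring
            _ ≤ C * weight (x - a i) * (1 * 1 ^ 2) := by
                gcongr <;> exact weight_le_one _
            _ = _ := by ring
      _ ≤ C * (s.card * R⁻¹) := by
          rw [← Finset.mul_sum]
          gcongr
          exact sum_erase_weight_le hR0 ha (by linarith)
      _ = (2 * C / c * s.card) * R⁻¹ * (c / 2) := by field_simp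
      _ ≤ R * R⁻¹ * (c / 2) := by gcongr
      _ = c / 2 := by rw [mul_inv_cancel₀ hR0.ne', one_mul]
  have := norm_sub_le_norm_add
    (stft h (toDist (SchwartzMap.compSubConstCLM ℂ (a j) h)) x η)
    (∑ i ∈ s.erase j, stft h (toDist (SchwartzMap.compSubConstCLM ℂ (a i) h)) x η)
  linarith

/-- Sums of `N` sparse translates have `M^{p,q}` norm at least a multiple of `N^{1/p}`. -/
theorem exists_le_modNorm_sumTranslates {d : ℕ} {h : 𝓢(EuclideanSpace ℝ (Fin d), ℂ)}
    (hh : h ≠ 0) {p q : ℝ≥0∞} (hp : 1 ≤ p) (hq : 1 ≤ q) :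
    ∃ (K : ℝ≥0∞) (A : ℝ), K ≠ 0 ∧
      ∀ (s : Finset ℕ) (a : ℕ → EuclideanSpace ℝ (Fin d)) (R : ℝ), s.Nonempty → 1 ≤ R →
      A * s.card ≤ R → (∀ i j, i ≠ j → 2 * R ≤ ‖a i - a j‖) →
      K * (s.card : ℝ≥0∞) ^ (1 / p.toReal) ≤ modNorm h p q (toDist (sumTranslates s a h)) := by
  obtain ⟨c, r, A, hc, hr, hr1, hlow⟩ := exists_le_norm_stft_sumTranslates hh
  set v : ℝ≥0∞ := volume (Metric.ball (0 : EuclideanSpace ℝ (Fin d)) r) with hv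
  have hv0 : v ≠ 0 := (Metric.measure_ball_pos volume _ hr).ne'
  have hvt : v ≠ ∞ := measure_ball_lt_top.ne
  refine ⟨ENNReal.ofReal c * v ^ (1 / p.toReal) * v ^ (1 / q.toReal), A, ?_,
    fun s a R hs hR hA ha => ?_⟩
  · have h1 : ∀ z : ℝ, v ^ z ≠ 0 := fun z => (ENNReal.rpow_pos hv0.bot_lt hvt).ne'
    simp [h1, hc]
  have hU := measure_biUnion_ball (s := s) (hr1.trans hR) ha
  have inner_ge : ∀ η ∈ Metric.ball (0 : EuclideanSpace ℝ (Fin d)) r,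
      ENNReal.ofReal c * (s.card * v) ^ (1 / p.toReal) ≤
        eLpNorm (fun x => stft h (toDist (sumTranslates s a h)) x η) p volume := fun η hη => by
    rw [hv, ← hU]
    refine mul_rpow_measure_le_eLpNorm (s.measurableSet_biUnion fun i _ => measurableSet_ball)
      ?_ (by positivity) fun x hx => ?_
    · rw [hU]
      exact mul_ne_zero (by simpa using hs.ne_empty) hv0
    · obtain ⟨j, hj, hx⟩ := Set.mem_iUnion₂.1 hx
      rw [← ofReal_norm]
      exact ENNReal.ofReal_le_ofReal (hlow s a R hR hA ha j hj x η (by simpa [dist_eq_norm] using hx)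
        (by simpa using hη))
  have outer := mul_rpow_measure_le_eLpNorm (μ := volume) (p := q) (f := fun η =>
    eLpNorm (fun x => stft h (toDist (sumTranslates s a h)) x η) p volume) measurableSet_ball hv0
    (by positivity) (by simpa only [enorm_eq_self] using inner_ge)
  refine le_trans (le_of_eq ?_) outer
  rw [ENNReal.mul_rpow_of_nonneg _ _ (by positivity)]
  ring

/-- Chirped sums of `N` sparse translates of a suitable function have `M^{p,q}` norm at least a
multiple of `N^{1/q}`. -/
theorem exists_le_modNorm_rateChirpMul_sumTranslates {d : ℕ}
    {h : 𝓢(EuclideanSpace ℝ (Fin d), ℂ)} (hh : h ≠ 0) {p q : ℝ≥0∞} (hp : 1 ≤ p) (hq : 1 ≤ q) :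
    ∃ (K : ℝ≥0∞) (A : ℝ), K ≠ 0 ∧
      ∀ (s : Finset ℕ) (a : ℕ → EuclideanSpace ℝ (Fin d)) (R : ℝ), s.Nonempty → 1 ≤ R →
      A * s.card ≤ R → (∀ i j, i ≠ j → 2 * R ≤ ‖a i - a j‖) →
      K * (s.card : ℝ≥0∞) ^ (1 / q.toReal) ≤
        modNorm h p q (toDist (rateChirpMul 1 (sumTranslates s a (rateChirpMul (-1) h)))) := by
  have hh' : rateChirpMul (-1) h ≠ 0 := fun h0 => hh <| by
    rw [← rateChirpMul_rateChirpMul_neg 1 h, h0]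
    ext t
    simp [rateChirpMul_apply]
  -- The shear replaces the window `h` by `rateChirpMul (-1) h`. Translating this same function
  -- makes the window match the summands, so the lower bound applies.
  obtain ⟨c, r, A, hc, hr, hr1, hlow⟩ := exists_le_norm_stft_sumTranslates hh'
  -- Half the radius: the sheared frequency `η - x` is small when `x` and `η` are both within `r /
  -- 2` of the same `a j`.
  set v : ℝ≥0∞ := volume (Metric.ball (0 : EuclideanSpace ℝ (Fin d)) (r / 2)) with hv
  have hv0 : v ≠ 0 := (Metric.measure_ball_pos volume _ (half_pos hr)).ne'
  have hvt : v ≠ ∞ := measure_ball_lt_top.ne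
  refine ⟨ENNReal.ofReal c * v ^ (1 / p.toReal) * v ^ (1 / q.toReal), A, ?_,
    fun s a R hs hR hA ha => ?_⟩
  · have h1 : ∀ z : ℝ, v ^ z ≠ 0 := fun z => (ENNReal.rpow_pos hv0.bot_lt hvt).ne'
    simp [h1, hc]
  have hU := measure_biUnion_ball (s := s) (show r / 2 ≤ R by linarith) ha
  have inner_ge : ∀ η ∈ ⋃ i ∈ s, Metric.ball (a i) (r / 2),
      ENNReal.ofReal c * v ^ (1 / p.toReal) ≤ eLpNorm (fun x => stft h
        (toDist (rateChirpMul 1 (sumTranslates s a (rateChirpMul (-1) h)))) x η) p volume :=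
      fun η hη => by
    obtain ⟨j, hj, hη⟩ := Set.mem_iUnion₂.1 hη
    rw [hv, ← Measure.addHaar_ball_center volume (a j)]
    refine mul_rpow_measure_le_eLpNorm measurableSet_ball
      (Metric.measure_ball_pos volume _ (half_pos hr)).ne' (by positivity) fun x hx => ?_
    rw [← ofReal_norm, norm_stft_rateChirpMul]
    rw [Metric.mem_ball, dist_eq_norm] at hx hη
    refine ENNReal.ofReal_le_ofReal (hlow s a R hR hA ha j hj x _ (by linarith) ?_)
    have := norm_sub_le (η - a j) (x - a j)
    rw [sub_sub_sub_cancel_right] at this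
    rw [one_smul]
    linarith
  have outer := mul_rpow_measure_le_eLpNorm (μ := volume) (p := q) (f := fun η =>
    eLpNorm (fun x => stft h
      (toDist (rateChirpMul 1 (sumTranslates s a (rateChirpMul (-1) h)))) x η) p volume)
    (s.measurableSet_biUnion fun i _ => measurableSet_ball)
    (by rw [hU]; exact mul_ne_zero (by simpa using hs.ne_empty) hv0)
    (by positivity) (by simpa only [enorm_eq_self] using inner_ge)
  refine le_trans (le_of_eq ?_) outer
  rw [hU, ENNReal.mul_rpow_of_nonneg _ _ (by positivity)]
  ring

/-! ### Choice of points, comparison of powers and conclusion -/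

theorem exists_separated {d : ℕ} (hd : 1 ≤ d) {R : ℝ} (hR : 0 ≤ R) :
    ∃ a : ℕ → EuclideanSpace ℝ (Fin d), ∀ i j, i ≠ j → 2 * R ≤ ‖a i - a j‖ := by
  refine ⟨fun i => EuclideanSpace.single ⟨0, hd⟩ (2 * R * i), fun i j hij => ?_⟩
  have h1 : (1 : ℝ) ≤ |(i : ℝ) - j| := by
    have : (1 : ℤ) ≤ |(i : ℤ) - j| := Int.one_le_abs (by omega)
    exact_mod_cast this
  rw [← dist_eq_norm, PiLp.dist_single_same, Real.dist_eq, ← mul_sub, abs_mul,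
    abs_of_nonneg (by positivity : 0 ≤ 2 * R)]
  exact le_mul_of_one_le_right (by positivity) h1

/-- A Schwartz function approximates itself with error zero. -/
theorem toDist_mem_schwartzClosure {d : ℕ} {g f : 𝓢(EuclideanSpace ℝ (Fin d), ℂ)}
    {p q : ℝ≥0∞} (hf : toDist f ∈ modulationSpace g p q) :
    toDist f ∈ schwartzClosure g p q := by
  refine ⟨hf, fun ε hε => ⟨f, ?_⟩⟩
  have h0 : ∀ x η, stft g (0 : 𝓢'(EuclideanSpace ℝ (Fin d), ℂ)) x η = 0 := fun x η => rfl
  have : modNorm g p q (toDist f - toDist f) = 0 := by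
    simp [modNorm, h0]
  exact this.trans_lt hε

/-- A power of `N` does not dominate a larger one. -/
theorem exists_nat_mul_rpow_lt {c K : ℝ≥0∞} (hc : c ≠ 0) (hK : K ≠ ∞) {α β : ℝ} (h : β < α) :
    ∃ N : ℕ, 0 < N ∧ K * (N : ℝ≥0∞) ^ β < c * (N : ℝ≥0∞) ^ α := by
  have ht : Filter.Tendsto (fun N : ℕ => (N : ℝ≥0∞) ^ (α - β)) Filter.atTop (nhds ∞) :=
    (ENNReal.tendsto_rpow_at_top (sub_pos.2 h)).comp ENNReal.tendsto_nat_nhds_top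
  have hlt : K / c < ∞ := ENNReal.div_lt_top hK hc
  obtain ⟨N, hN, hN0⟩ := ((ht.eventually (lt_mem_nhds hlt)).and
    (Filter.eventually_gt_atTop 0)).exists
  refine ⟨N, hN0, ?_⟩
  have hNz : (N : ℝ≥0∞) ≠ 0 := by exact_mod_cast hN0.ne'
  have hb0 : (N : ℝ≥0∞) ^ β ≠ 0 := (ENNReal.rpow_pos hNz.bot_lt (by simp)).ne'
  have hbt : (N : ℝ≥0∞) ^ β ≠ ∞ := ENNReal.rpow_ne_top_of_ne_zero hNz (by simp)
  rw [show α = (α - β) + β by ring, ENNReal.rpow_add _ _ hNz (by simp), ← mul_assoc]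
  refine ENNReal.mul_lt_mul_left hb0 hbt ?_
  rw [mul_comm]
  exact (ENNReal.div_lt_iff (Or.inl hc) (Or.inr hK)).1 hN

theorem one_div_toReal_lt {p q : ℝ≥0∞} (hp : 1 ≤ p) (h : p < q) :
    1 / q.toReal < 1 / p.toReal := by
  have hp0 : 0 < p.toReal :=
    ENNReal.toReal_pos (zero_lt_one.trans_le hp).ne' (h.trans_le le_top).ne
  rcases eq_or_ne q ∞ with rfl | hq
  · simpa using hp0
  · exact one_div_lt_one_div_of_lt hp0 ((ENNReal.toReal_lt_toReal (h.trans_le le_top).ne hq).2 h)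

/-- Chirp multiplication increases the `M^{p,q}` norm of Schwartz functions by arbitrarily large
factors if `p ≠ q`. -/
theorem exists_schwartz_modNorm_chirpMul_gt {d : ℕ} (hd : 1 ≤ d) {p q : ℝ≥0∞} (hp : 1 ≤ p)
    (hq : 1 ≤ q) (hpq : p ≠ q) {g : 𝓢(EuclideanSpace ℝ (Fin d), ℂ)} (hg : g ≠ 0) (C : ℝ≥0) :
    ∃ f : 𝓢(EuclideanSpace ℝ (Fin d), ℂ), toDist f ∈ modulationSpace g p q ∧
      C * modNorm g p q (toDist f) < modNorm g p q (chirpMul (toDist f)) := by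
  have points : ∀ (A : ℝ) (N : ℕ), ∃ (a : ℕ → EuclideanSpace ℝ (Fin d)) (R : ℝ), 1 ≤ R ∧
      N ≤ R ∧ A * N ≤ R ∧ ∀ i j, i ≠ j → 2 * R ≤ ‖a i - a j‖ := fun A N => by
    have hR : 1 ≤ max 1 (max (N : ℝ) (A * N)) := le_max_left _ _
    obtain ⟨a, ha⟩ := exists_separated hd (zero_le_one.trans hR)
    exact ⟨a, _, hR, (le_max_left _ _).trans (le_max_right _ _),
      (le_max_right _ _).trans (le_max_right _ _), ha⟩
  rcases hpq.lt_or_gt with h | h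
  -- Case `p < q`: the test function is the sum chirped with rate `-1`, of norm `O(N^{1/q})`, and
  -- `U` restores the plain sum.
  · obtain ⟨K, hK, up⟩ := exists_modNorm_rateChirpMul_sumTranslates_le g g hp hq
    obtain ⟨c, A, hc, low⟩ := exists_le_modNorm_sumTranslates hg hp hq
    obtain ⟨N, hN, hlt⟩ := exists_nat_mul_rpow_lt hc
      (ENNReal.mul_ne_top ENNReal.coe_ne_top hK : C * K ≠ ∞) (one_div_toReal_lt hp h)
    obtain ⟨a, R, hR, hNR, hAR, ha⟩ := points A N
    have hu := up (Finset.range N) a R (by linarith) (by simpa using hNR) ha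
    have hl := low (Finset.range N) a R (by simpa using hN.ne') hR (by simpa using hAR) ha
    rw [Finset.card_range] at hu hl
    refine ⟨_, hu.trans_lt (ENNReal.mul_lt_top hK.lt_top
      (ENNReal.rpow_lt_top_of_nonneg (by positivity) (by simp))), ?_⟩
    rw [chirpMul_toDist, rateChirpMul_rateChirpMul_neg]
    refine lt_of_le_of_lt ?_ (hlt.trans_le hl)
    rw [mul_assoc]
    gcongr
  -- Case `q < p`: the test function is the plain sum of translates of `rateChirpMul (-1) g`, and
  -- `U` spreads it over frequencies.
  · obtain ⟨K, hK, up⟩ := exists_modNorm_sumTranslates_le g (rateChirpMul (-1) g) hp hq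
    obtain ⟨c, A, hc, low⟩ := exists_le_modNorm_rateChirpMul_sumTranslates hg hp hq
    obtain ⟨N, hN, hlt⟩ := exists_nat_mul_rpow_lt hc
      (ENNReal.mul_ne_top ENNReal.coe_ne_top hK : C * K ≠ ∞) (one_div_toReal_lt hq h)
    obtain ⟨a, R, hR, hNR, hAR, ha⟩ := points A N
    have hu := up (Finset.range N) a R (by linarith) (by simpa using hNR) ha
    have hl := low (Finset.range N) a R (by simpa using hN.ne') hR (by simpa using hAR) ha
    rw [Finset.card_range] at hu hl
    refine ⟨_, hu.trans_lt (ENNReal.mul_lt_top hK.lt_top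
      (ENNReal.rpow_lt_top_of_nonneg (by positivity) (by simp))), ?_⟩
    rw [chirpMul_toDist]
    refine lt_of_le_of_lt ?_ (hlt.trans_le hl)
    rw [mul_assoc]
    gcongr

end ModulationSpaces

end

theorem proposition7p1 (d : ℕ) (hd : 1 ≤ d) (p q : ℝ≥0∞) (hp : 1 ≤ p) (hq : 1 ≤ q) (hpq : p ≠ q)
    (g : 𝓢(EuclideanSpace ℝ (Fin d), ℂ)) (hg : g ≠ 0) :
    ¬ ModulationSpaces.IsBoundedOn g p q (ModulationSpaces.modulationSpace g p q)
        ModulationSpaces.chirpMul ∧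
    ¬ ModulationSpaces.IsBoundedOn g p q (ModulationSpaces.schwartzClosure g p q)
        ModulationSpaces.chirpMul := by
  constructor
  · rintro ⟨C, hC⟩
    obtain ⟨f, hf, hlt⟩ := ModulationSpaces.exists_schwartz_modNorm_chirpMul_gt hd hp hq hpq hg C
    exact (hC _ hf).not_gt hlt
  · rintro ⟨C, hC⟩
    obtain ⟨f, hf, hlt⟩ := ModulationSpaces.exists_schwartz_modNorm_chirpMul_gt hd hp hq hpq hg C
    exact (hC _ (ModulationSpaces.toDist_mem_schwartzClosure hf)).not_gt hlt
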